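/- Let $\psi^{ABE}$ be a state (density operator, pure or mixed) of a qubit $A$, with orthonormal amplitude basis $|0\rangle,|1\rangle$ and $P_z=|z\rangle\langle z|$, and of finite-dimensional quantum systems $B$ and $E$. Let $\psi^{AE}=\mathrm{Tr}_B\,\psi^{ABE}$ and $\psi^{E}=\mathrm{Tr}_A\,\psi^{AE}$, and let $$\psi^{Z^AE}=\sum_{z=0}^1 (P_z^A\otimes\mathbb 1^E)\,\psi^{AE}\,(P_z^A\otimes\mathbb 1^E)$$ be the state after the amplitude measurement of $A$. Let $H(Z^A|E)_\psi=H(\psi^{Z^AE})-H(\psi^E)$, where $H(\rho)=-\mathrm{Tr}\,\rho\log_2\rho$ is the von Neumann entropy in bits, and let $$p_{\rm secure}(Z^A|E)_\psi=1-\tfrac12\big\|\psi^{Z^AE}-\tfrac12\mathbb 1^A\otimes\psi^E\big\|_1,\qquad \|M\|_1=\mathrm{Tr}\sqrt{M^\dagger M}.$$ For every real $\epsilon\ge 0$: if $H(Z^A|E)_\psi\ge 1-\epsilon^2$, then $p_{\rm secure}(Z^A|E)_\psi\ge 1-\epsilon$. -/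

import Mathlib

open scoped Matrix Kronecker MatrixOrder ComplexOrder

namespace QInfo

/-- The trace norm `‖M‖₁ = Tr √(Mᴴ M)` of a complex square matrix. The trace is a nonnegative real
number, so `re` only changes its type. -/
noncomputable def traceNorm {n : Type*} [Fintype n] [DecidableEq n] (M : Matrix n n ℂ) : ℝ :=
  (CFC.sqrt (Mᴴ * M)).trace.re

/-- The Shannon entropy in bits, with `0 log 0 = 0`. -/
noncomputable def shannonEntropy {n : Type*} [Fintype n] (p : n → ℝ) : ℝ :=
  -∑ i, p i * Real.logb 2 (p i)

/-- A state of the finite-dimensional quantum system `ℂⁿ`: a density matrix. A composite system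
has a product as its index type. -/
structure State (n : Type*) [Fintype n] where
  /-- the density matrix -/
  mat : Matrix n n ℂ
  posSemidef : mat.PosSemidef
  trace_eq_one : mat.trace = 1

/-- The von Neumann entropy: the Shannon entropy of the eigenvalues (with multiplicity) of the
density matrix. -/
noncomputable def State.entropy {n : Type*} [Fintype n] [DecidableEq n] (ρ : State n) : ℝ :=
  shannonEntropy ρ.posSemidef.isHermitian.eigenvalues

/-- The marginal `ψ^{AE} = Tr_B ψ^{ABE}`. -/
def State.traceMid {A B E : Type*} [Fintype A] [Fintype B] [Fintype E]
    (ψ : State (A × B × E)) : State (A × E) where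
  mat := Matrix.of fun i j => ∑ b, ψ.mat (i.1, b, i.2) (j.1, b, j.2)
  posSemidef := by
    have h : (Matrix.of fun i j : A × E => ∑ b, ψ.mat (i.1, b, i.2) (j.1, b, j.2)) =
        ∑ b, ψ.mat.submatrix (fun i : A × E => (i.1, b, i.2)) (fun i => (i.1, b, i.2)) := by
      ext i j
      simp [Matrix.sum_apply]
    rw [h]
    exact Matrix.posSemidef_sum _ fun b _ => ψ.posSemidef.submatrix _
  trace_eq_one := by
    rw [← ψ.trace_eq_one]
    simp only [Matrix.trace, Matrix.diag, Matrix.of_apply, Fintype.sum_prod_type]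
    exact Finset.sum_congr rfl fun a _ => Finset.sum_comm

/-- The marginal `ρ^E = Tr_A ρ^{AE}`. -/
def State.traceLeft {A E : Type*} [Fintype A] [Fintype E] (ρ : State (A × E)) : State E where
  mat := Matrix.of fun i j => ∑ a, ρ.mat (a, i) (a, j)
  posSemidef := by
    have h : (Matrix.of fun i j : E => ∑ a, ρ.mat (a, i) (a, j)) =
        ∑ a, ρ.mat.submatrix (fun i : E => (a, i)) (fun i => (a, i)) := by
      ext i j
      simp [Matrix.sum_apply]
    rw [h]
    exact Matrix.posSemidef_sum _ fun a _ => ρ.posSemidef.submatrix _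
  trace_eq_one := by
    rw [← ρ.trace_eq_one]
    simp only [Matrix.trace, Matrix.diag, Matrix.of_apply, Fintype.sum_prod_type]
    exact Finset.sum_comm

/-- The quantum conditional entropy `H(A|E) = H(AE) - H(E)`. -/
noncomputable def State.condEntropy {A E : Type*} [Fintype A] [DecidableEq A] [Fintype E]
    [DecidableEq E] (ρ : State (A × E)) : ℝ :=
  ρ.entropy - ρ.traceLeft.entropy

/-- The projector `P_z = |z⟩⟨z|` onto an amplitude eigenstate of a qubit, `Z|z⟩ = (-1)^z |z⟩`. -/
def ampProj (z : Fin 2) : Matrix (Fin 2) (Fin 2) ℂ :=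
  Matrix.single z z 1

/-- The state `ψ^{Z^A E} = ∑_z (P_z ⊗ 1) ψ^{AE} (P_z ⊗ 1)` after the amplitude `Z` of the qubit `A`
has been measured. -/
def State.measureZ {E : Type*} [Fintype E] [DecidableEq E] (ρ : State (Fin 2 × E)) :
    State (Fin 2 × E) where
  mat := ∑ z, (ampProj z ⊗ₖ (1 : Matrix E E ℂ)) * ρ.mat * (ampProj z ⊗ₖ (1 : Matrix E E ℂ))
  posSemidef := by
    refine Matrix.posSemidef_sum _ fun z _ => ?_
    have h : (ampProj z ⊗ₖ (1 : Matrix E E ℂ))ᴴ = ampProj z ⊗ₖ (1 : Matrix E E ℂ) := by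
      simp [Matrix.conjTranspose_kronecker, ampProj]
    have := ρ.posSemidef.conjTranspose_mul_mul_same (ampProj z ⊗ₖ (1 : Matrix E E ℂ))
    rwa [h] at this
  trace_eq_one := by
    rw [Matrix.trace_sum, ← ρ.trace_eq_one]
    have h : ∀ z, ((ampProj z ⊗ₖ (1 : Matrix E E ℂ)) * ρ.mat *
        (ampProj z ⊗ₖ (1 : Matrix E E ℂ))).trace =
        ((ampProj z ⊗ₖ (1 : Matrix E E ℂ)) * ρ.mat).trace := by
      intro z
      rw [Matrix.trace_mul_comm, ← Matrix.mul_assoc, ← Matrix.mul_kronecker_mul]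
      simp [ampProj]
    simp_rw [h]
    rw [← Matrix.trace_sum, ← Finset.sum_mul]
    have h1 : ∑ z, (ampProj z ⊗ₖ (1 : Matrix E E ℂ)) = 1 := by
      rw [Fin.sum_univ_two, ← Matrix.add_kronecker, ← Matrix.one_kronecker_one]
      congr 1
      ext i j
      fin_cases i <;> fin_cases j <;> simp [ampProj]
    rw [h1, one_mul]

/-- `H(Z^A|E)_ψ`: the conditional entropy of the state after the amplitude of `A` has been
measured. -/
noncomputable def condEntropyZ {B E : Type*} [Fintype B] [Fintype E] [DecidableEq E]
    (ψ : State (Fin 2 × B × E)) : ℝ :=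
  ψ.traceMid.measureZ.condEntropy

/-- `p_secure(Z^A|E)_ψ = 1 - ½ ‖ψ^{Z^A E} - ½ 1^A ⊗ ψ^E‖₁`. -/
noncomputable def pSecureZ {B E : Type*} [Fintype B] [Fintype E] [DecidableEq E]
    (ψ : State (Fin 2 × B × E)) : ℝ :=
  1 - 1 / 2 * traceNorm (ψ.traceMid.measureZ.mat -
    ((1 / 2 : ℂ) • (1 : Matrix (Fin 2) (Fin 2) ℂ)) ⊗ₖ ψ.traceMid.traceLeft.mat)

end QInfo

/-!
Let `S = ψ^E`, let `ρ = ψ^{Z^A E}` and `σ = ½ 1 ⊗ S`. As `ρ` has the marginal `S`, the entropy defect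
`1 - H(Z^A|E)` is the relative entropy `D(ρ‖σ)` in bits, and the claim is an inequality of Pinsker
type. The constant asked for is weaker than the optimal one, so that the data processing inequality
is not needed: `D(ρ‖σ)` and `‖ρ - σ‖₁` are both compared with `c = Tr √ρ √σ`.

* Write `ρ = U diag(p) Uᴴ`, `σ = V diag(q) Vᴴ` and `W i j = |(Uᴴ V) i j|²`. Then
  `D(ρ‖σ) = ∑ W i j p i (log p i - log q j)` is the classical relative entropy of the
  Nussbaum–Szkoła distributions `W i j p i` and `W i j q j`, and `log x ≤ x - 1` at `x = √(q j / p i)`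
  bounds it below, in nats, by `2 (1 - c)`.
* The Powers–Størmer argument (`traceNorm_sq_sub_sq_le`) gives
  `‖ρ - σ‖₁² ≤ Tr (√ρ - √σ)² · Tr (√ρ + √σ)² = (2 - 2c) (2 + 2c)`.

As `c ≤ 1`, these combine to `‖ρ - σ‖₁² ≤ 4 D(ρ‖σ)` in nats (`traceNorm_sub_sq_le_relEntropy`).
The term `Tr ρ log σ` is evaluated in the product of the standard basis of `A` with an eigenbasis of
`S`, which gives `State.sq_traceNorm_sub_le` for a system `A` of any dimension. In bits the constant
is `4 log 2 ≤ 4`, whence `½ ‖ρ - σ‖₁ ≤ ε`.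
-/

namespace QInfo

open Matrix

/-! ### Trace norm and Hilbert–Schmidt norm -/

/-- For a Hermitian matrix `Tr X²` is the squared Hilbert–Schmidt norm. -/
theorem re_trace_mul_self {n : Type*} [Fintype n] {X : Matrix n n ℂ} (hX : X.IsHermitian) :
    (X * X).trace.re = ∑ k, ∑ l, ‖X k l‖ ^ 2 := by
  simp only [trace, diag, mul_apply, Complex.re_sum]
  refine Finset.sum_congr rfl fun k _ => Finset.sum_congr rfl fun l _ => ?_
  rw [← hX.apply l k, ← Complex.normSq_eq_norm_sq, Complex.star_def, Complex.mul_conj]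
  rw [Complex.ofReal_re]

variable {n : Type*} [Fintype n] [DecidableEq n]

/-- The spectral theorem as an identity between matrices, for the eigenvalues chosen by Mathlib. -/
theorem exists_unitary_eq_conj_diagonal {M : Matrix n n ℂ} (hM : M.IsHermitian) :
    ∃ U ∈ unitaryGroup n ℂ, M = U * diagonal (fun i => (hM.eigenvalues i : ℂ)) * star U :=
  ⟨_, hM.eigenvectorUnitary.2, hM.spectral_theorem⟩

theorem sum_sq_norm_row_of_mem_unitaryGroup {W : Matrix n n ℂ} (hW : W ∈ unitaryGroup n ℂ)
    (i : n) : ∑ j, ‖W i j‖ ^ 2 = 1 := by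
  have h1 := congrFun (congrFun (mem_unitaryGroup_iff.1 hW) i) i
  rw [mul_apply, one_apply_eq] at h1
  have h2 := congrArg Complex.re h1
  simp only [Complex.re_sum, star_apply, Complex.star_def, Complex.mul_conj, Complex.ofReal_re,
    Complex.normSq_eq_norm_sq, Complex.one_re] at h2
  exact h2

theorem traceNorm_eq_sum_abs_eigenvalues {M : Matrix n n ℂ} (hM : M.IsHermitian) :
    traceNorm M = ∑ i, |hM.eigenvalues i| := by
  obtain ⟨U, hUm, hspec⟩ := exists_unitary_eq_conj_diagonal hM
  have hU := mem_unitaryGroup_iff'.1 hUm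
  have hsqrt : CFC.sqrt (Mᴴ * M) =
      U * diagonal (fun i => ((|hM.eigenvalues i| : ℝ) : ℂ)) * star U := by
    refine CFC.sqrt_unique ?_ ?_
    · have h : ∀ i j : n → ℂ, U * diagonal i * star U * (U * diagonal j * star U) =
          U * (diagonal i * diagonal j) * star U := by
        intro i j
        simp only [Matrix.mul_assoc]
        rw [← Matrix.mul_assoc (star U) U, hU, Matrix.one_mul]
      rw [hM.eq]
      conv_rhs => rw [hspec]
      rw [h, h, diagonal_mul_diagonal, diagonal_mul_diagonal]
      congr 3
      ext i
      exact_mod_cast abs_mul_abs_self _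
    · rw [Matrix.nonneg_iff_posSemidef]
      refine PosSemidef.mul_mul_conjTranspose_same (PosSemidef.diagonal fun i => ?_) U
      simp
  rw [traceNorm, hsqrt, Matrix.trace_mul_cycle, hU, Matrix.one_mul, trace_diagonal]
  simp

/-- The Powers–Størmer argument: `a² - b²` is the symmetrized product of `a - b` and `a + b`, and in
an eigenbasis of `a² - b²` the Cauchy–Schwarz inequality over all pairs of indices separates the two
factors. -/
theorem traceNorm_sq_sub_sq_le {a b : Matrix n n ℂ} (ha : a.IsHermitian) (hb : b.IsHermitian) :
    traceNorm (a * a - b * b) ^ 2 ≤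
      ((a - b) * (a - b)).trace.re * ((a + b) * (a + b)).trace.re := by
  have hM : (a * a - b * b).IsHermitian := by
    simp [IsHermitian, conjTranspose_mul, ha.eq, hb.eq]
  rw [traceNorm_eq_sum_abs_eigenvalues hM]
  obtain ⟨U, hUm, hspec⟩ := exists_unitary_eq_conj_diagonal hM
  have hU := mem_unitaryGroup_iff.1 hUm
  have hU' := mem_unitaryGroup_iff'.1 hUm
  have hconj : ∀ x y : Matrix n n ℂ, (star U * x * U) * (star U * y * U) =
      star U * (x * y) * U := by
    intro x y
    simp only [Matrix.mul_assoc]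
    rw [← Matrix.mul_assoc U (star U), hU, Matrix.one_mul]
  have htr : ∀ x : Matrix n n ℂ, (star U * x * U).trace = x.trace := by
    intro x
    rw [Matrix.trace_mul_cycle, hU, Matrix.one_mul]
  have hherm : ∀ x : Matrix n n ℂ, x.IsHermitian → (star U * x * U).IsHermitian :=
    fun x hx => isHermitian_conjTranspose_mul_mul U hx
  -- `X` and `Y` are `a - b` and `a + b` in an eigenbasis of `a² - b²`.
  obtain ⟨X, hX⟩ : ∃ X, X = star U * (a - b) * U := ⟨_, rfl⟩
  obtain ⟨Y, hY⟩ : ∃ Y, Y = star U * (a + b) * U := ⟨_, rfl⟩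
  have hXh : X.IsHermitian := hX ▸ hherm _ (ha.sub hb)
  have hYh : Y.IsHermitian := hY ▸ hherm _ (ha.add hb)
  have hD : diagonal (fun i => (hM.eigenvalues i : ℂ)) + diagonal (fun i => (hM.eigenvalues i : ℂ))
      = X * Y + Y * X := by
    have h1 : diagonal (fun i => (hM.eigenvalues i : ℂ)) = star U * (a * a - b * b) * U := by
      conv_rhs => rw [hspec]
      simp only [Matrix.mul_assoc]
      rw [hU', Matrix.mul_one, ← Matrix.mul_assoc, hU', Matrix.one_mul]
    rw [h1, hX, hY, hconj, hconj]
    noncomm_ring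
  have hk : ∀ k, |hM.eigenvalues k| ≤ ∑ l, ‖X k l‖ * ‖Y k l‖ := by
    intro k
    have h1 := congrArg (fun M : Matrix n n ℂ => ‖M k k‖) hD
    simp only [Matrix.add_apply, diagonal_apply_eq, mul_apply] at h1
    rw [← two_mul, norm_mul, Complex.norm_real, Real.norm_eq_abs, Complex.norm_ofNat] at h1
    have h2 := (norm_add_le (∑ l, X k l * Y l k) (∑ l, Y k l * X l k)).trans
      (add_le_add (norm_sum_le _ _) (norm_sum_le _ _))
    rw [← h1] at h2
    have e1 : ∀ l, ‖X k l * Y l k‖ = ‖X k l‖ * ‖Y k l‖ := fun l => by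
      rw [norm_mul, ← hYh.apply l k, norm_star]
    have e2 : ∀ l, ‖Y k l * X l k‖ = ‖X k l‖ * ‖Y k l‖ := fun l => by
      rw [norm_mul, ← hXh.apply l k, norm_star, mul_comm]
    simp only [e1, e2] at h2
    linarith
  have hXX : ((a - b) * (a - b)).trace.re = ∑ k, ∑ l, ‖X k l‖ ^ 2 := by
    rw [← re_trace_mul_self hXh, hX, hconj, htr]
  have hYY : ((a + b) * (a + b)).trace.re = ∑ k, ∑ l, ‖Y k l‖ ^ 2 := by
    rw [← re_trace_mul_self hYh, hY, hconj, htr]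
  rw [hXX, hYY]
  calc (∑ k, |hM.eigenvalues k|) ^ 2 ≤ (∑ k, ∑ l, ‖X k l‖ * ‖Y k l‖) ^ 2 := by
        gcongr with k
        exact hk k
    _ ≤ _ := by
        simp only [← Fintype.sum_prod_type']
        exact Finset.sum_mul_sq_le_sq_mul_sq _ _ _

/-! ### Relative entropy in a pair of eigenbases -/

theorem trace_conj_diagonal_mul_conj_diagonal (U V : Matrix n n ℂ) (f g : n → ℝ) :
    ((U * diagonal (fun i => (f i : ℂ)) * star U) *
      (V * diagonal (fun j => (g j : ℂ)) * star V)).trace.re =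
      ∑ i, ∑ j, ‖(star U * V) i j‖ ^ 2 * (f i * g j) := by
  have h : ((U * diagonal (fun i => (f i : ℂ)) * star U) *
      (V * diagonal (fun j => (g j : ℂ)) * star V)).trace =
      (diagonal (fun i => (f i : ℂ)) * (star U * V) * diagonal (fun j => (g j : ℂ)) *
        star (star U * V)).trace := by
    rw [star_mul, star_star]
    simp only [Matrix.mul_assoc]
    rw [Matrix.trace_mul_comm]
    simp only [Matrix.mul_assoc]
  rw [h]
  simp only [trace, diag, mul_apply (N := star (star U * V)), Complex.re_sum, mul_diagonal,
    diagonal_mul, star_apply]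
  refine Finset.sum_congr rfl fun i _ => Finset.sum_congr rfl fun j _ => ?_
  generalize (star U * V) i j = z
  rw [← Complex.normSq_eq_norm_sq, Complex.star_def,
    show (f i : ℂ) * z * g j * (starRingEnd ℂ) z = f i * g j * (z * (starRingEnd ℂ) z) by ring,
    Complex.mul_conj, ← Complex.ofReal_mul, ← Complex.ofReal_mul, Complex.ofReal_re]
  ring

/-- The summand of the relative entropy against the summand of `2 (1 - ∑ √p √q)`. The hypothesis `h`
excludes the case in which the relative entropy is infinite, while `Real.log 0 = 0`. -/
theorem two_mul_sub_sqrt_mul_sqrt_le {p q : ℝ} (hp : 0 ≤ p) (hq : 0 ≤ q) (h : q = 0 → p = 0) :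
    2 * (p - √p * √q) ≤ p * (Real.log p - Real.log q) := by
  rcases hp.eq_or_lt with rfl | hp
  · simp
  have hq : 0 < q := hq.lt_of_ne fun h0 => hp.ne' (h h0.symm)
  have hs := Real.sqrt_pos.2 hp
  have ht := Real.sqrt_pos.2 hq
  have h1 := Real.log_le_sub_one_of_pos (div_pos ht hs)
  rw [Real.log_div ht.ne' hs.ne', Real.log_sqrt hp.le, Real.log_sqrt hq.le] at h1
  have h2 := mul_le_mul_of_nonneg_left h1 hp.le
  have h3 : p * (√q / √p - 1) = √p * √q - p := by
    rw [mul_sub, mul_div_assoc', mul_one]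
    nth_rw 1 [← Real.mul_self_sqrt hp.le]
    field_simp
  linarith

/-- `‖ρ - σ‖₁² ≤ 4 D(ρ‖σ)`, with the relative entropy in nats, for states `ρ = U diag(p) Uᴴ` and
`σ = V diag(q) Vᴴ`. The double sum is `Tr ρ (log ρ - log σ)`, and `hpq` says that the support of `ρ`
lies in that of `σ`. -/
theorem traceNorm_sub_sq_le_relEntropy {U V : Matrix n n ℂ} (hU : U ∈ unitaryGroup n ℂ)
    (hV : V ∈ unitaryGroup n ℂ) {p q : n → ℝ} (hp : ∀ i, 0 ≤ p i) (hq : ∀ i, 0 ≤ q i)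
    (hp1 : ∑ i, p i = 1) (hq1 : ∑ i, q i = 1)
    (hpq : ∀ i j, q j = 0 → ‖(star U * V) i j‖ ^ 2 * p i = 0) :
    traceNorm (U * diagonal (fun i => (p i : ℂ)) * star U -
      V * diagonal (fun i => (q i : ℂ)) * star V) ^ 2 ≤
      4 * ∑ i, ∑ j, ‖(star U * V) i j‖ ^ 2 * p i * (Real.log (p i) - Real.log (q j)) := by
  have sq : ∀ {W : Matrix n n ℂ}, W ∈ unitaryGroup n ℂ → ∀ {r : n → ℝ}, (∀ i, 0 ≤ r i) →
      W * diagonal (fun i => (r i : ℂ)) * star W =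
      (W * diagonal (fun i => ((√(r i) : ℝ) : ℂ)) * star W) *
      (W * diagonal (fun i => ((√(r i) : ℝ) : ℂ)) * star W) := by
    intro W hW r hr
    simp only [Matrix.mul_assoc]
    rw [← Matrix.mul_assoc (star W) W, mem_unitaryGroup_iff'.1 hW, Matrix.one_mul,
      ← Matrix.mul_assoc (diagonal _), diagonal_mul_diagonal]
    congr 3
    ext i
    rw [← Complex.ofReal_mul, Real.mul_self_sqrt (hr i)]
  have herm : ∀ (W : Matrix n n ℂ) (r : n → ℝ),
      (W * diagonal (fun i => (r i : ℂ)) * star W).IsHermitian := by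
    intro W r
    refine isHermitian_mul_mul_conjTranspose W (isHermitian_diagonal_of_self_adjoint _ ?_)
    ext i
    simp
  have tr : ∀ {W : Matrix n n ℂ}, W ∈ unitaryGroup n ℂ → ∀ r : n → ℝ,
      (W * diagonal (fun i => (r i : ℂ)) * star W).trace.re = ∑ i, r i := by
    intro W hW r
    rw [Matrix.trace_mul_cycle, mem_unitaryGroup_iff'.1 hW, Matrix.one_mul, trace_diagonal]
    simp
  -- From here on `a = √ρ` and `b = √σ`.
  have hc := trace_conj_diagonal_mul_conj_diagonal U V (fun i => √(p i)) (fun i => √(q i))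
  have hpa := tr hU p
  have hqb := tr hV q
  rw [sq hU hp, sq hV hq]
  rw [sq hU hp, hp1] at hpa
  rw [sq hV hq, hq1] at hqb
  have ha := herm U fun i => √(p i)
  have hb := herm V fun i => √(q i)
  generalize U * diagonal (fun i => ((√(p i) : ℝ) : ℂ)) * star U = a at *
  generalize V * diagonal (fun i => ((√(q i) : ℝ) : ℂ)) * star V = b at *
  have hPS := traceNorm_sq_sub_sq_le ha hb
  set c := (a * b).trace.re with hcdef
  have hsub : ((a - b) * (a - b)).trace.re = 2 - 2 * c := by
    simp only [Matrix.sub_mul, Matrix.mul_sub, trace_sub, Complex.sub_re, trace_mul_comm b a, hpa,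
      hqb, ← hcdef]
    ring
  have hadd : ((a + b) * (a + b)).trace.re = 2 + 2 * c := by
    simp only [Matrix.add_mul, Matrix.mul_add, trace_add, Complex.add_re, trace_mul_comm b a, hpa,
      hqb, ← hcdef]
    ring
  have hc1 : c ≤ 1 := by
    have : 0 ≤ ((a - b) * (a - b)).trace.re := by
      rw [re_trace_mul_self (ha.sub hb)]
      positivity
    linarith
  rw [hsub, hadd] at hPS
  have hW1 := sum_sq_norm_row_of_mem_unitaryGroup (mul_mem (Unitary.star_mem hU) hV)
  have hD : 2 - 2 * c ≤
      ∑ i, ∑ j, ‖(star U * V) i j‖ ^ 2 * p i * (Real.log (p i) - Real.log (q j)) := by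
    have h1 : 2 - 2 * c = ∑ i, ∑ j, ‖(star U * V) i j‖ ^ 2 * (2 * (p i - √(p i) * √(q j))) := by
      have h2 : (1 : ℝ) = ∑ i, ∑ j, ‖(star U * V) i j‖ ^ 2 * p i := by
        simp only [← Finset.sum_mul, hW1, one_mul, hp1]
      rw [hc]
      nth_rw 1 [← mul_one (2 : ℝ)]
      rw [h2]
      simp only [Finset.mul_sum, ← Finset.sum_sub_distrib]
      refine Finset.sum_congr rfl fun i _ => Finset.sum_congr rfl fun j _ => ?_
      ring
    rw [h1]
    refine Finset.sum_le_sum fun i _ => Finset.sum_le_sum fun j _ => ?_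
    rw [mul_assoc]
    rcases eq_or_ne (‖(star U * V) i j‖ ^ 2) 0 with h0 | h0
    · simp [h0]
    · exact mul_le_mul_of_nonneg_left (two_mul_sub_sqrt_mul_sqrt_le (hp i) (hq j) fun h =>
        (mul_eq_zero.1 (hpq i j h)).resolve_left h0) (by positivity)
  -- `(2 - 2c) (2 + 2c) ≤ 4 (2 - 2c)` because `c ≤ 1`.
  nlinarith

/-! ### Conditional entropy and distance from uniform -/

theorem State.sum_eigenvalues (ρ : State n) : ∑ i, ρ.posSemidef.isHermitian.eigenvalues i = 1 := by
  have h := ρ.posSemidef.isHermitian.trace_eq_sum_eigenvalues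
  rw [ρ.trace_eq_one] at h
  have h' := congrArg Complex.re h
  simpa using h'.symm

/-- The von Neumann entropy in nats. -/
theorem State.log_two_mul_entropy (ρ : State n) :
    Real.log 2 * ρ.entropy = -∑ i, ρ.posSemidef.isHermitian.eigenvalues i *
      Real.log (ρ.posSemidef.isHermitian.eigenvalues i) := by
  have h2 : Real.log 2 ≠ 0 := (Real.log_pos one_lt_two).ne'
  rw [State.entropy, shannonEntropy, mul_neg, Finset.mul_sum]
  refine congrArg _ (Finset.sum_congr rfl fun i _ => ?_)
  rw [Real.logb]
  field_simp

theorem State.trace_mul_one_kronecker {A E : Type*} [Fintype A] [DecidableEq A] [Fintype E]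
    (ρ : State (A × E)) (K : Matrix E E ℂ) :
    (ρ.mat * ((1 : Matrix A A ℂ) ⊗ₖ K)).trace = (ρ.traceLeft.mat * K).trace := by
  simp only [trace, diag, mul_apply, State.traceLeft, of_apply, Fintype.sum_prod_type,
    kroneckerMap_apply, one_apply, ite_mul, one_mul, zero_mul, mul_ite, mul_zero,
    Finset.sum_mul]
  rw [Finset.sum_comm]
  refine Finset.sum_congr rfl fun e _ => ?_
  simp only [Finset.sum_comm (s := (Finset.univ : Finset A)) (t := (Finset.univ : Finset E))]
  simp

/-- If `H(A|E)` is close to its maximum, then `ρ` is close to the state in which `A` is uniform and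
independent of `E`: the bracket on the right is the relative entropy of the two states in nats. -/
theorem State.sq_traceNorm_sub_le {A E : Type*} [Fintype A] [DecidableEq A] [Fintype E]
    [DecidableEq E] [Nonempty A] (ρ : State (A × E)) :
    traceNorm (ρ.mat - (((Fintype.card A : ℂ)⁻¹ • (1 : Matrix A A ℂ)) ⊗ₖ ρ.traceLeft.mat)) ^ 2 ≤
      4 * (Real.log (Fintype.card A) - Real.log 2 * ρ.condEntropy) := by
  have hd : (Fintype.card A : ℝ) ≠ 0 := by simp
  set hρ := ρ.posSemidef.isHermitian
  set hS := ρ.traceLeft.posSemidef.isHermitian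
  obtain ⟨U, hUm, hspec⟩ := exists_unitary_eq_conj_diagonal hρ
  obtain ⟨v, hvm, hspecS⟩ := exists_unitary_eq_conj_diagonal hS
  set p := hρ.eigenvalues
  set s := hS.eigenvalues
  have hp1 : ∑ i, p i = 1 := ρ.sum_eigenvalues
  have hs1 : ∑ i, s i = 1 := ρ.traceLeft.sum_eigenvalues
  have hp0 : ∀ i, 0 ≤ p i := ρ.posSemidef.eigenvalues_nonneg
  have hs0 : ∀ i, 0 ≤ s i := ρ.traceLeft.posSemidef.eigenvalues_nonneg
  have hstar : star ((1 : Matrix A A ℂ) ⊗ₖ v) = (1 : Matrix A A ℂ) ⊗ₖ star v := by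
    simp [star_eq_conjTranspose, conjTranspose_kronecker]
  have hVm : (1 : Matrix A A ℂ) ⊗ₖ v ∈ unitaryGroup (A × E) ℂ := by
    rw [mem_unitaryGroup_iff, hstar, ← mul_kronecker_mul, mem_unitaryGroup_iff.1 hvm, one_mul,
      one_kronecker_one]
  have hdiag : ∀ g : E → ℝ, ((1 : Matrix A A ℂ) ⊗ₖ v) *
      diagonal (fun k : A × E => (g k.2 : ℂ)) * star ((1 : Matrix A A ℂ) ⊗ₖ v) =
      (1 : Matrix A A ℂ) ⊗ₖ (v * diagonal (fun j => (g j : ℂ)) * star v) := by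
    intro g
    have : diagonal (fun k : A × E => (g k.2 : ℂ)) =
        (1 : Matrix A A ℂ) ⊗ₖ diagonal (fun j => (g j : ℂ)) := by
      rw [← diagonal_one, diagonal_kronecker_diagonal]
      simp
    rw [this, hstar, ← mul_kronecker_mul, ← mul_kronecker_mul, one_mul, one_mul]
  have hσ : ((Fintype.card A : ℂ)⁻¹ • (1 : Matrix A A ℂ)) ⊗ₖ ρ.traceLeft.mat =
      ((1 : Matrix A A ℂ) ⊗ₖ v) * diagonal (fun k : A × E =>
        (((Fintype.card A : ℝ)⁻¹ * s k.2 : ℝ) : ℂ)) * star ((1 : Matrix A A ℂ) ⊗ₖ v) := by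
    rw [hdiag (fun j => (Fintype.card A : ℝ)⁻¹ * s j), smul_kronecker, ← kronecker_smul]
    conv_lhs => rw [hspecS]
    rw [← Matrix.smul_mul, ← Matrix.mul_smul, ← diagonal_smul]
    congr 4
    ext j
    simp
  -- Weighted with `W i k p i`, a function of the `E`-index has its mean in the spectrum of the
  -- marginal; this is `Tr ρ (1 ⊗ K) = Tr S K` for `K` diagonal in the eigenbasis of `S`.
  have hmarg : ∀ g : E → ℝ, ∑ i, ∑ k : A × E,
      ‖(star U * ((1 : Matrix A A ℂ) ⊗ₖ v)) i k‖ ^ 2 * (p i * g k.2) = ∑ j, s j * g j := by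
    intro g
    rw [← trace_conj_diagonal_mul_conj_diagonal U _ p (fun k => g k.2), ← hspec, hdiag,
      ρ.trace_mul_one_kronecker]
    conv_lhs => rw [hspecS]
    rw [trace_conj_diagonal_mul_conj_diagonal, mem_unitaryGroup_iff'.1 hvm]
    refine Finset.sum_congr rfl fun i _ => ?_
    rw [Finset.sum_eq_single i] <;> simp +contextual [one_apply, eq_comm]
  have hW1 := sum_sq_norm_row_of_mem_unitaryGroup (mul_mem (Unitary.star_mem hUm) hVm)
  -- The support condition: where `s j = 0`, the marginal identity for the indicator of `j` is a
  -- vanishing sum of nonnegative terms.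
  have hsupp : ∀ i (k : A × E), (Fintype.card A : ℝ)⁻¹ * s k.2 = 0 →
      ‖(star U * ((1 : Matrix A A ℂ) ⊗ₖ v)) i k‖ ^ 2 * p i = 0 := by
    intro i k hk
    have hk : s k.2 = 0 := (mul_eq_zero.1 hk).resolve_left (inv_ne_zero hd)
    have h1 := hmarg (Pi.single k.2 1)
    simp only [Pi.single_apply, mul_ite, mul_one, mul_zero, Finset.sum_ite_eq', Finset.mem_univ,
      if_true, hk] at h1
    have h0 : ∀ i (l : A × E), 0 ≤ if l.2 = k.2 then
        ‖(star U * ((1 : Matrix A A ℂ) ⊗ₖ v)) i l‖ ^ 2 * p i else 0 := by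
      intro i l
      have := hp0 i
      split_ifs <;> positivity
    have h2 := (Finset.sum_eq_zero_iff_of_nonneg
      (fun i _ => Finset.sum_nonneg fun l _ => h0 i l)).1 h1 i (Finset.mem_univ _)
    simpa using (Finset.sum_eq_zero_iff_of_nonneg (fun l _ => h0 i l)).1 h2 k (Finset.mem_univ _)
  have key := traceNorm_sub_sq_le_relEntropy hUm hVm hp0
    (q := fun k => (Fintype.card A : ℝ)⁻¹ * s k.2) (fun k => mul_nonneg (by positivity) (hs0 _))
    hp1 (by
      rw [Fintype.sum_prod_type]
      simp [← Finset.mul_sum, hs1]) hsupp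
  rw [← hspec, ← hσ] at key
  refine key.trans_eq ?_
  congr 1
  rw [State.condEntropy, mul_sub, ρ.log_two_mul_entropy, ρ.traceLeft.log_two_mul_entropy]
  have hlog : ∀ i (k : A × E), ‖(star U * ((1 : Matrix A A ℂ) ⊗ₖ v)) i k‖ ^ 2 * p i *
      (Real.log (p i) - Real.log ((Fintype.card A : ℝ)⁻¹ * s k.2)) =
      ‖(star U * ((1 : Matrix A A ℂ) ⊗ₖ v)) i k‖ ^ 2 * (p i * Real.log (p i)) -
      ‖(star U * ((1 : Matrix A A ℂ) ⊗ₖ v)) i k‖ ^ 2 *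
        (p i * (Real.log (s k.2) - Real.log (Fintype.card A))) := by
    intro i k
    rcases eq_or_ne (s k.2) 0 with h0 | h0
    · have h1 := hsupp i k (by simp [h0])
      rw [← mul_assoc, ← mul_assoc, h1]
      simp
    · rw [Real.log_mul (inv_ne_zero hd) h0, Real.log_inv]
      ring
  simp only [hlog, Finset.sum_sub_distrib]
  rw [hmarg (fun j => Real.log (s j) - Real.log (Fintype.card A))]
  simp only [← Finset.sum_mul, hW1, one_mul, mul_sub, Finset.sum_sub_distrib, hs1]
  change _ = Real.log _ - (-(∑ i, p i * Real.log (p i)) - -(∑ i, s i * Real.log (s i)))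
  ring

/-- Measuring `A` does not disturb `E`. -/
theorem State.traceLeft_measureZ {E : Type*} [Fintype E] [DecidableEq E]
    (ρ : State (Fin 2 × E)) : ρ.measureZ.traceLeft.mat = ρ.traceLeft.mat := by
  ext i j
  simp [State.traceLeft, State.measureZ, ampProj, mul_apply,
    Fintype.sum_prod_type, Fin.sum_univ_two, kroneckerMap_apply, single_apply, one_apply]

end QInfo

theorem mainTheorem10 {B E : Type*} [Fintype B] [Fintype E] [DecidableEq E]
    (ψ : QInfo.State (Fin 2 × B × E)) (ε : ℝ) (hε : 0 ≤ ε)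
    (h : 1 - ε ^ 2 ≤ QInfo.condEntropyZ ψ) :
    1 - ε ≤ QInfo.pSecureZ ψ := by
  have key := ψ.traceMid.measureZ.sq_traceNorm_sub_le
  rw [QInfo.State.traceLeft_measureZ] at key
  rw [QInfo.condEntropyZ] at h
  rw [QInfo.pSecureZ]
  simp only [Fintype.card_fin, Nat.cast_ofNat, ← one_div] at key
  have hlog0 : 0 < Real.log 2 := Real.log_pos one_lt_two
  have hlog1 : Real.log 2 ≤ 1 := by linarith [Real.log_two_lt_d9]
  -- `4 log 2 (1 - H) ≤ 4 log 2 ε² ≤ (2 ε)²`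
  have := abs_le_of_sq_le_sq' (b := 2 * ε) (key.trans (by nlinarith)) (by positivity)
  linarith [this.2]
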